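/- Let $k$ be a field and let $q\ge 1$, $m\ge 0$ be integers with $\gcd(2q+1,m)=1$ (so $m\ge 1$). Let $R=k[[x_1,x_2,x_3]]$, $T=k[x_1,x_2,x_3]$, $T'=k[x_2,x_3]\cong T/x_1T$, and let $\mathfrak p\subset R$ be the kernel of the substitution homomorphism $R\to k[[t]]$, $x_i\mapsto t^{2q+1+(i-1)m}$ ($i=1,2,3$), i.e. the defining ideal of the monomial curve $(t^{2q+1},t^{2q+1+m},t^{2q+1+2m})$. For $n\ge 1$ let $\mathfrak p^{(n)}=\mathfrak p^nR_{\mathfrak p}\cap R$ be the $n$-th symbolic power. Put $$g_1=x_1^{m+q}x_2-x_3^{q+1},\quad g_2=x_1^{m+q+1}-x_2x_3^q,\quad g_3=x_2^2-x_1x_3,$$ $$f_2=-x_1^{2(m+q)+1}-x_1^{m+q-1}x_2^3x_3^{q-1}+3x_1^{m+q}x_2x_3^q-x_3^{2q+1},$$ and define, the sums being over all integers $a_1,a_2\ge 0$ with $a_1+2a_2=n$, the ideals $$\mathcal I_n=\sum_{a_1+2a_2=n}(g_1,g_2,g_3)^{a_1}(f_2)^{a_2}\subset T,\qquad I_n=\sum_{a_1+2a_2=n}(x_2^2,\,x_2x_3^q,\,x_3^{q+1})^{a_1}(x_3^{2q+1})^{a_2}\subset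 T'.$$ Then for every $n\ge 1$: (1) $\mathfrak p^{(n)}=\mathcal I_nR$; (2) $\mathfrak p^{(n)}=\sum_{a_1+2a_2=n}\mathfrak p^{a_1}(\mathfrak p^{(2)})^{a_2}$; (3) setting $x_1=0$ carries $\mathfrak p^{(n)}$ and $\mathcal I_n$ to the monomial ideal $I_n$. Precisely, the image of $\mathfrak p^{(n)}$ in $k[[x_2,x_3]]$ is $I_n\,k[[x_2,x_3]]$, and the images in $T'$ of both $\mathfrak p^{(n)}\cap T$ and $\mathcal I_n$ are equal to $I_n$. -/

import Mathlib

noncomputable section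

/-- The `n`-th symbolic power of a prime ideal `P` of `A`, i.e. the contraction to `A`
of the ideal `P ^ n A_P` of the localization `A_P`. -/
def symbolicPower {A : Type*} [CommRing A] (P : Ideal A) [P.IsPrime] (n : ℕ) : Ideal A :=
  ((P ^ n).map (algebraMap A (Localization.AtPrime P))).comap
    (algebraMap A (Localization.AtPrime P))

/-- The ideal `∑ I ^ a₁ * J ^ a₂`, the sum over all `a₁, a₂ ≥ 0` with `a₁ + 2 a₂ = n`. -/
def weightedSum {A : Type*} [CommSemiring A] (I J : Ideal A) (n : ℕ) : Ideal A :=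
  ⨆ (a : ℕ × ℕ) (_ : a.1 + 2 * a.2 = n), I ^ a.1 * J ^ a.2

namespace MonomialCurve

variable (k : Type*) [Field k] (q m : ℕ)

/-! Variables: in three variables `X 0, X 1, X 2` are `x₁, x₂, x₃`;
in two variables `X 0, X 1` are `x₂, x₃`. -/

/-- The images `t ^ (2q+1), t ^ (2q+1+m), t ^ (2q+1+2m)` of `x₁, x₂, x₃` in `k[[t]]`. -/
def param (i : Fin 3) : PowerSeries k := PowerSeries.X ^ (2 * q + 1 + (i : ℕ) * m)

theorem hasSubst_param : MvPowerSeries.HasSubst (param k q m) := by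
  refine MvPowerSeries.hasSubst_of_constantCoeff_zero fun i => ?_
  change PowerSeries.constantCoeff (param k q m i) = 0
  rw [param, map_pow, PowerSeries.constantCoeff_X]
  exact zero_pow (by omega)

/-- The substitution homomorphism `k[[x₁,x₂,x₃]] → k[[t]]`, `xᵢ ↦ t ^ (2q+1+(i-1)m)`. -/
def phi : MvPowerSeries (Fin 3) k →ₐ[k] PowerSeries k :=
  MvPowerSeries.substAlgHom (hasSubst_param k q m)

/-- The defining ideal of the curve in `k[[x₁,x₂,x₃]]`. -/
def curveIdeal : Ideal (MvPowerSeries (Fin 3) k) := RingHom.ker (phi k q m)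

instance curveIdeal_isPrime : (curveIdeal k q m).IsPrime :=
  RingHom.ker_isPrime (phi k q m)

open MvPolynomial

def g₁ : MvPolynomial (Fin 3) k := X 0 ^ (m + q) * X 1 - X 2 ^ (q + 1)

def g₂ : MvPolynomial (Fin 3) k := X 0 ^ (m + q + 1) - X 1 * X 2 ^ q

def g₃ : MvPolynomial (Fin 3) k := X 1 ^ 2 - X 0 * X 2

def f₂ : MvPolynomial (Fin 3) k :=
  - X 0 ^ (2 * (m + q) + 1) - X 0 ^ (m + q - 1) * X 1 ^ 3 * X 2 ^ (q - 1)
    + 3 * X 0 ^ (m + q) * X 1 * X 2 ^ q - X 2 ^ (2 * q + 1)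

/-- The ideal `∑ (g₁,g₂,g₃) ^ a₁ (f₂) ^ a₂`, `a₁ + 2 a₂ = n`, of `k[x₁,x₂,x₃]`. -/
def calI (n : ℕ) : Ideal (MvPolynomial (Fin 3) k) :=
  weightedSum (Ideal.span {g₁ k q m, g₂ k q m, g₃ k}) (Ideal.span {f₂ k q m}) n

/-- The monomial ideal `∑ (x₂², x₂ x₃^q, x₃^(q+1)) ^ a₁ (x₃^(2q+1)) ^ a₂`, `a₁ + 2 a₂ = n`,
of `k[x₂,x₃]`. -/
def monI (n : ℕ) : Ideal (MvPolynomial (Fin 2) k) :=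
  weightedSum (Ideal.span {X 0 ^ 2, X 0 * X 1 ^ q, X 1 ^ (q + 1)})
    (Ideal.span {X 1 ^ (2 * q + 1)}) n

/-- The inclusion of the polynomial ring in the power series ring. -/
def toSeries (d : ℕ) : MvPolynomial (Fin d) k →+* MvPowerSeries (Fin d) k :=
  MvPolynomial.coeToMvPowerSeries.ringHom

/-- The homomorphism `k[x₁,x₂,x₃] → k[x₂,x₃]` that sets `x₁ = 0`. -/
def reducePoly : MvPolynomial (Fin 3) k →ₐ[k] MvPolynomial (Fin 2) k :=
  MvPolynomial.aeval ![0, X 0, X 1]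

theorem hasSubst_reduce :
    MvPowerSeries.HasSubst
      (![0, MvPowerSeries.X 0, MvPowerSeries.X 1] : Fin 3 → MvPowerSeries (Fin 2) k) := by
  refine MvPowerSeries.hasSubst_of_constantCoeff_zero fun i => ?_
  fin_cases i <;> simp

/-- The homomorphism `k[[x₁,x₂,x₃]] → k[[x₂,x₃]]` that sets `x₁ = 0`. -/
def reduceSeries : MvPowerSeries (Fin 3) k →ₐ[k] MvPowerSeries (Fin 2) k :=
  MvPowerSeries.substAlgHom (hasSubst_reduce k)

end MonomialCurve

end

/-! Write `x, y, z` for the variables and `P` for the curve ideal. The ring `R/P` embeds in `k[[t]]`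
and contains every series of large order, so each element outside `P` divides a power of `x` modulo
`P`. Hence `P^(n)` consists of the `h` with `x^a h ∈ P^n` for some `a`.

The generators `gᵢ` are, up to sign, the minors of the matrix with rows `(x, y, z^q)` and `(y, z,
x^(m+q))`. Modulo `g₃ P`, the products `g₁², g₁g₂, g₂²` are `-zf, -yf, -xf`. So `f ∈ P^(2)`, and
`P^n` lies in the ideal `L_n` (`reducedIdeal`) spanned by normal forms at most linear in `g₁, g₂`.
The crux is that `x` is a nonzerodivisor modulo `L_n` (`mem_reducedIdeal_of_mul_mem`); then `P^(n) ⊆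
L_n ⊆ calI`, and the reverse inclusions follow from `f ∈ P^(2)`.

That the `gᵢ` generate `P` follows from Nakayama's lemma and a count of weights. At `x = 0` the
generators of `calI` become monomials up to sign, and monomial ideals are contracted from power
series. -/

/-- Elements of a commutative ring satisfying the equations that define `g₁, g₂, g₃, f₂`
(with `q = p + 1` and `m + q = e + 2`), where `x` and `(x, y)` are prime. -/
structure CurveRelations {R : Type*} [CommRing R] (x y z g₁ g₂ g₃ f : R) (p e : ℕ) : Prop where
  prime_x : Prime x
  prime_xy : (Ideal.span {x, y}).IsPrime
  y_notMem : ¬ x ∣ y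
  z_notMem : z ∉ Ideal.span {x, y}
  g₁_eq : g₁ = x ^ (e + 2) * y - z ^ (p + 2)
  g₂_eq : g₂ = x ^ (e + 3) - y * z ^ (p + 1)
  g₃_eq : g₃ = y ^ 2 - x * z
  f_eq : f = -x ^ (2 * e + 5) - x ^ (e + 1) * y ^ 3 * z ^ p + 3 * x ^ (e + 2) * y * z ^ (p + 1)
    - z ^ (2 * p + 3)

/-- The ideal generated by the products `f ^ b` and `gᵢ * f ^ b`, `i = 1, 2`, of weight `n`. -/
def tailIdeal {R : Type*} [CommRing R] (g₁ g₂ f : R) (n : ℕ) : Ideal R :=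
  Ideal.span {g₁, g₂} ^ (n % 2) * Ideal.span {f} ^ (n / 2)

/-- The ideal generated by the products `g₃ ^ a * f ^ b` and `g₃ ^ a * gᵢ * f ^ b`, `i = 1, 2`,
of weight `n`, where `g₁, g₂, g₃` have weight `1` and `f` has weight `2`. -/
def reducedIdeal {R : Type*} [CommRing R] (g₁ g₂ g₃ f : R) : ℕ → Ideal R
  | 0 => ⊤
  | n + 1 => Ideal.span {g₃} * reducedIdeal g₁ g₂ g₃ f n ⊔ tailIdeal g₁ g₂ f (n + 1)

/-! ### Normal forms of weight `n` -/

section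
variable {R : Type*} [CommRing R] {g₁ g₂ g₃ f : R}

theorem tailIdeal_even (d : ℕ) : tailIdeal g₁ g₂ f (2 * d) = Ideal.span {f ^ d} := by
  rw [tailIdeal, Nat.mul_mod_right, Nat.mul_div_cancel_left _ two_pos, pow_zero, one_mul,
    Ideal.span_singleton_pow]

theorem tailIdeal_odd (d : ℕ) :
    tailIdeal g₁ g₂ f (2 * d + 1) = Ideal.span {g₁ * f ^ d, g₂ * f ^ d} := by
  rw [tailIdeal, show (2 * d + 1) % 2 = 1 by omega, show (2 * d + 1) / 2 = d by omega, pow_one,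
    Ideal.span_singleton_pow, Ideal.span_mul_span', Set.mul_singleton, Set.image_pair]

theorem tailIdeal_le_reducedIdeal (n : ℕ) :
    tailIdeal g₁ g₂ f n ≤ reducedIdeal g₁ g₂ g₃ f n := by
  cases n with
  | zero => exact le_top
  | succ n => exact le_sup_right

theorem g₃_mul_mem_reducedIdeal {n : ℕ} {h : R} (hh : h ∈ reducedIdeal g₁ g₂ g₃ f n) :
    g₃ * h ∈ reducedIdeal g₁ g₂ g₃ f (n + 1) :=
  Ideal.mem_sup_left (Ideal.mul_mem_mul (Ideal.mem_span_singleton_self _) hh)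

theorem f_pow_mem_reducedIdeal (d : ℕ) : f ^ d ∈ reducedIdeal g₁ g₂ g₃ f (2 * d) :=
  tailIdeal_le_reducedIdeal _ (by rw [tailIdeal_even]; exact Ideal.mem_span_singleton_self _)

theorem g₁_mul_f_pow_mem_reducedIdeal (d : ℕ) :
    g₁ * f ^ d ∈ reducedIdeal g₁ g₂ g₃ f (2 * d + 1) :=
  tailIdeal_le_reducedIdeal _ (by rw [tailIdeal_odd]; exact Ideal.subset_span (by simp))

theorem g₂_mul_f_pow_mem_reducedIdeal (d : ℕ) :
    g₂ * f ^ d ∈ reducedIdeal g₁ g₂ g₃ f (2 * d + 1) :=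
  tailIdeal_le_reducedIdeal _ (by rw [tailIdeal_odd]; exact Ideal.subset_span (by simp))

theorem mem_reducedIdeal_succ_iff {n : ℕ} {h : R} :
    h ∈ reducedIdeal g₁ g₂ g₃ f (n + 1) ↔
      ∃ u ∈ reducedIdeal g₁ g₂ g₃ f n, ∃ v ∈ tailIdeal g₁ g₂ f (n + 1), g₃ * u + v = h := by
  rw [reducedIdeal, Submodule.mem_sup]
  simp only [Ideal.mem_span_singleton_mul]
  constructor
  · rintro ⟨_, ⟨u, hu, rfl⟩, v, hv, rfl⟩
    exact ⟨u, hu, v, hv, rfl⟩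
  · rintro ⟨u, hu, v, hv, rfl⟩
    exact ⟨_, ⟨u, hu, rfl⟩, v, hv, rfl⟩

/-- The reduced ideals are contained in the weighted sums. -/
theorem reducedIdeal_le_weightedSum (n : ℕ) :
    reducedIdeal g₁ g₂ g₃ f n ≤ weightedSum (Ideal.span {g₁, g₂, g₃}) (Ideal.span {f}) n := by
  have hle : ∀ n a b : ℕ, a + 2 * b = n →
      Ideal.span {g₁, g₂, g₃} ^ a * Ideal.span {f} ^ b ≤
        weightedSum (Ideal.span {g₁, g₂, g₃}) (Ideal.span {f}) n := fun n a b h =>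
    le_iSup₂_of_le (a, b) h le_rfl
  induction n with
  | zero =>
    refine le_trans ?_ (hle 0 0 0 rfl)
    simp
  | succ n ih =>
    refine sup_le ?_ ?_
    · refine (Ideal.mul_mono_right ih).trans ?_
      simp only [weightedSum, Ideal.mul_iSup]
      refine iSup₂_le fun a ha => ?_
      refine le_trans ?_ (hle (n + 1) (a.1 + 1) a.2 (by omega))
      rw [← mul_assoc, pow_succ']
      gcongr
      simp
    · refine le_trans ?_ (hle (n + 1) ((n + 1) % 2) ((n + 1) / 2) (Nat.mod_add_div _ _))
      rw [tailIdeal]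
      gcongr
      simp

end

theorem f_mul_mem_reducedIdeal {R : Type*} [CommRing R] {g₁ g₂ g₃ f : R} {n : ℕ} {h : R}
    (hh : h ∈ reducedIdeal g₁ g₂ g₃ f n) : f * h ∈ reducedIdeal g₁ g₂ g₃ f (n + 2) := by
  induction n generalizing h with
  | zero =>
    have := f_pow_mem_reducedIdeal (g₁ := g₁) (g₂ := g₂) (g₃ := g₃) (f := f) 1
    rw [pow_one] at this
    exact Ideal.mul_mem_right _ _ this
  | succ n ih =>
    obtain ⟨u, hu, v, hv, rfl⟩ := mem_reducedIdeal_succ_iff.1 hh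
    rw [mul_add, mul_left_comm]
    refine add_mem (g₃_mul_mem_reducedIdeal (ih hu)) (tailIdeal_le_reducedIdeal _ ?_)
    rw [tailIdeal, show (n + 1 + 2) % 2 = (n + 1) % 2 by omega,
      show (n + 1 + 2) / 2 = (n + 1) / 2 + 1 by omega, pow_succ, ← mul_assoc, mul_comm f]
    exact Ideal.mul_mem_mul hv (Ideal.mem_span_singleton_self _)

theorem f_pow_mul_mem_reducedIdeal {R : Type*} [CommRing R] {g₁ g₂ g₃ f : R} {n : ℕ} {h : R}
    (hh : h ∈ reducedIdeal g₁ g₂ g₃ f n) (d : ℕ) :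
    f ^ d * h ∈ reducedIdeal g₁ g₂ g₃ f (n + 2 * d) := by
  induction d with
  | zero => simpa using hh
  | succ d ih =>
    rw [pow_succ', mul_assoc]
    exact f_mul_mem_reducedIdeal ih

/-- Multiplication by `g` commutes with the factors `g₃` and `f` of a normal form, so only its
products with `1`, `g₁` and `g₂` need checking. -/
theorem mul_mem_reducedIdeal_of_mul_mem {R : Type*} [CommRing R] {g₁ g₂ g₃ f g : R}
    (h₀ : g ∈ reducedIdeal g₁ g₂ g₃ f 1)
    (h₁ : g * g₁ ∈ reducedIdeal g₁ g₂ g₃ f 2) (h₂ : g * g₂ ∈ reducedIdeal g₁ g₂ g₃ f 2)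
    {n : ℕ} {h : R} (hh : h ∈ reducedIdeal g₁ g₂ g₃ f n) :
    g * h ∈ reducedIdeal g₁ g₂ g₃ f (n + 1) := by
  induction n generalizing h with
  | zero => exact Ideal.mul_mem_right _ _ h₀
  | succ n ih =>
    obtain ⟨u, hu, v, hv, rfl⟩ := mem_reducedIdeal_succ_iff.1 hh
    rw [mul_add, mul_left_comm]
    refine add_mem (g₃_mul_mem_reducedIdeal (ih hu)) ?_
    obtain ⟨d, hd | hd⟩ := Nat.even_or_odd' (n + 1)
    · rw [hd, tailIdeal_even, Ideal.mem_span_singleton'] at hv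
      obtain ⟨c, rfl⟩ := hv
      rw [hd, show g * (c * f ^ d) = c * (f ^ d * g) by ring, add_comm]
      exact Ideal.mul_mem_left _ _ (f_pow_mul_mem_reducedIdeal h₀ d)
    · rw [hd, tailIdeal_odd, Ideal.mem_span_pair] at hv
      obtain ⟨a, b, rfl⟩ := hv
      rw [hd, show g * (a * (g₁ * f ^ d) + b * (g₂ * f ^ d)) =
        a * (f ^ d * (g * g₁)) + b * (f ^ d * (g * g₂)) by ring,
        show 2 * d + 1 + 1 = 2 + 2 * d by ring]
      exact add_mem (Ideal.mul_mem_left _ _ (f_pow_mul_mem_reducedIdeal h₁ d))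
        (Ideal.mul_mem_left _ _ (f_pow_mul_mem_reducedIdeal h₂ d))

/-! ### Syzygies, and regularity of `x` modulo the reduced ideals -/

namespace CurveRelations

variable {R : Type*} [CommRing R] {x y z g₁ g₂ g₃ f : R} {p e : ℕ}

/-- This and `y_mul_g₁` are the two Hilbert–Burch syzygies: a determinant with a repeated row
vanishes. -/
theorem y_mul_g₂ (H : CurveRelations x y z g₁ g₂ g₃ f p e) :
    y * g₂ = x * g₁ - z ^ (p + 1) * g₃ := by
  rw [H.g₁_eq, H.g₂_eq, H.g₃_eq]; ring

theorem y_mul_g₁ (H : CurveRelations x y z g₁ g₂ g₃ f p e) :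
    y * g₁ = z * g₂ + x ^ (e + 2) * g₃ := by
  rw [H.g₁_eq, H.g₂_eq, H.g₃_eq]; ring

theorem g₁_mul_g₁ (H : CurveRelations x y z g₁ g₂ g₃ f p e) :
    g₁ * g₁ = -z * f + x ^ (e + 1) * g₂ * g₃ := by
  rw [H.g₁_eq, H.g₂_eq, H.g₃_eq, H.f_eq]; ring

theorem g₁_mul_g₂ (H : CurveRelations x y z g₁ g₂ g₃ f p e) :
    g₁ * g₂ = -y * f - x ^ (e + 1) * z ^ p * g₃ * g₃ := by
  rw [H.g₁_eq, H.g₂_eq, H.g₃_eq, H.f_eq]; ring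

theorem g₂_mul_g₂ (H : CurveRelations x y z g₁ g₂ g₃ f p e) :
    g₂ * g₂ = -z ^ p * g₁ * g₃ - x * f := by
  rw [H.g₁_eq, H.g₂_eq, H.g₃_eq, H.f_eq]; ring

/-- Obtained by computing `y * g₁ * g₂` in two ways, from `y_mul_g₂` and from `g₁_mul_g₂`. -/
theorem y_sq_mul_f (H : CurveRelations x y z g₁ g₂ g₃ f p e) : y ^ 2 * f =
    z ^ (p + 1) * g₁ * g₃ - x * (g₁ * g₁) - x ^ (e + 1) * y * z ^ p * g₃ * g₃ := by
  rw [H.g₁_eq, H.g₃_eq, H.f_eq]; ring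

theorem g₁_mem : g₁ ∈ reducedIdeal g₁ g₂ g₃ f 1 := by
  simpa using g₁_mul_f_pow_mem_reducedIdeal (g₁ := g₁) (g₂ := g₂) (g₃ := g₃) (f := f) 0

theorem g₂_mem : g₂ ∈ reducedIdeal g₁ g₂ g₃ f 1 := by
  simpa using g₂_mul_f_pow_mem_reducedIdeal (g₁ := g₁) (g₂ := g₂) (g₃ := g₃) (f := f) 0

theorem g₃_mem : g₃ ∈ reducedIdeal g₁ g₂ g₃ f 1 := by
  simpa using g₃_mul_mem_reducedIdeal (n := 0) (g₁ := g₁) (g₂ := g₂) (g₃ := g₃) (f := f)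
    (h := 1) Submodule.mem_top

theorem f_mem : f ∈ reducedIdeal g₁ g₂ g₃ f 2 := by
  simpa using f_pow_mem_reducedIdeal (g₁ := g₁) (g₂ := g₂) (g₃ := g₃) (f := f) 1

theorem g₁_mul_g₁_mem (H : CurveRelations x y z g₁ g₂ g₃ f p e) :
    g₁ * g₁ ∈ reducedIdeal g₁ g₂ g₃ f 2 := by
  rw [H.g₁_mul_g₁, show -z * f + x ^ (e + 1) * g₂ * g₃ = -z * f + x ^ (e + 1) * (g₃ * g₂) by ring]
  exact add_mem (Ideal.mul_mem_left _ _ f_mem)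
    (Ideal.mul_mem_left _ _ (g₃_mul_mem_reducedIdeal g₂_mem))

theorem g₁_mul_g₂_mem (H : CurveRelations x y z g₁ g₂ g₃ f p e) :
    g₁ * g₂ ∈ reducedIdeal g₁ g₂ g₃ f 2 := by
  rw [H.g₁_mul_g₂, mul_assoc _ g₃]
  exact sub_mem (Ideal.mul_mem_left _ _ f_mem)
    (Ideal.mul_mem_left _ _ (g₃_mul_mem_reducedIdeal g₃_mem))

theorem g₂_mul_g₂_mem (H : CurveRelations x y z g₁ g₂ g₃ f p e) :
    g₂ * g₂ ∈ reducedIdeal g₁ g₂ g₃ f 2 := by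
  rw [H.g₂_mul_g₂, mul_assoc, mul_comm g₁]
  exact sub_mem (Ideal.mul_mem_left _ _ (g₃_mul_mem_reducedIdeal g₁_mem))
    (Ideal.mul_mem_left _ _ f_mem)

theorem span_pow_le_reducedIdeal (H : CurveRelations x y z g₁ g₂ g₃ f p e) (n : ℕ) :
    Ideal.span {g₁, g₂, g₃} ^ n ≤ reducedIdeal g₁ g₂ g₃ f n := by
  induction n with
  | zero => exact le_top
  | succ n ih =>
    rw [pow_succ']
    refine Ideal.mul_le.2 fun r hr s hs => ?_
    replace hs := ih hs
    obtain ⟨a, b, c, rfl⟩ := Submodule.mem_span_triple.1 hr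
    simp only [smul_eq_mul, add_mul, mul_assoc]
    refine add_mem (add_mem ?_ ?_) ?_ <;> refine Ideal.mul_mem_left _ _ ?_
    · exact mul_mem_reducedIdeal_of_mul_mem g₁_mem H.g₁_mul_g₁_mem H.g₁_mul_g₂_mem hs
    · exact mul_mem_reducedIdeal_of_mul_mem g₂_mem (mul_comm g₁ g₂ ▸ H.g₁_mul_g₂_mem)
        H.g₂_mul_g₂_mem hs
    · exact g₃_mul_mem_reducedIdeal hs

theorem dvd_of_dvd_g₃_mul (H : CurveRelations x y z g₁ g₂ g₃ f p e) {u : R} (h : x ∣ g₃ * u) :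
    x ∣ u := by
  refine (H.prime_x.dvd_or_dvd h).resolve_left fun h => H.y_notMem ?_
  refine H.prime_x.dvd_of_dvd_pow (n := 2) ?_
  rw [show y ^ 2 = g₃ + x * z by rw [H.g₃_eq]; ring]
  exact dvd_add h (dvd_mul_right _ _)

theorem f_notMem (H : CurveRelations x y z g₁ g₂ g₃ f p e) : f ∉ Ideal.span {x, y} := by
  have := H.prime_xy
  intro h
  refine H.z_notMem (this.mem_of_pow_mem (2 * p + 3) ?_)
  rw [Ideal.mem_span_pair] at h ⊢
  obtain ⟨a, b, h⟩ := h
  refine ⟨-x ^ (2 * e + 4) - x ^ e * y ^ 3 * z ^ p + 3 * x ^ (e + 1) * y * z ^ (p + 1) - a, -b, ?_⟩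
  linear_combination -(h.trans H.f_eq)

theorem g₁_notMem (H : CurveRelations x y z g₁ g₂ g₃ f p e) : g₁ ∉ Ideal.span {x, y} := by
  have := H.prime_xy
  intro h
  refine H.z_notMem (this.mem_of_pow_mem (p + 2) ?_)
  rw [Ideal.mem_span_pair] at h ⊢
  obtain ⟨a, b, h⟩ := h
  refine ⟨x ^ (e + 1) * y - a, -b, ?_⟩
  linear_combination -(h.trans H.g₁_eq)

/-- Modulo `x`, an element `c` with `y ∣ c * f ^ d` is divisible by `y`. -/
theorem mem_span_of_mul_f_pow (H : CurveRelations x y z g₁ g₂ g₃ f p e) {c : R} {d : ℕ}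
    (h : c * f ^ d ∈ Ideal.span {x, y}) : c ∈ Ideal.span {x, y} := by
  have := H.prime_xy
  exact (this.mem_or_mem h).resolve_right fun h => H.f_notMem (this.mem_of_pow_mem _ h)

/-- Write `x * h = g₃ * u + v` with `v` in the tail. Modulo `x`, the elements `g₁, g₂, g₃, f` are
monomials in `y, z` up to sign, which forces the coefficients of `v` into `(x, y)`. The syzygies
then turn `v` into a multiple of `g₃` plus `x * r`; the total cofactor of `g₃` is divisible by `x`,
and induction applies to the quotient. -/
theorem mem_reducedIdeal_of_mul_mem [IsDomain R] (H : CurveRelations x y z g₁ g₂ g₃ f p e) {n : ℕ}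
    {h : R} (hh : x * h ∈ reducedIdeal g₁ g₂ g₃ f n) : h ∈ reducedIdeal g₁ g₂ g₃ f n := by
  have hprime := H.prime_xy
  have hx0 := H.prime_x.ne_zero
  have dvd_of_y {w : R} (hw : x ∣ y * w) : x ∣ w :=
    (H.prime_x.dvd_or_dvd hw).resolve_left H.y_notMem
  induction n generalizing h with
  | zero => exact Submodule.mem_top
  | succ n ih =>
    obtain ⟨u, hu, v, hv, huv⟩ := mem_reducedIdeal_succ_iff.1 hh
    obtain ⟨d, hd | hd⟩ := Nat.even_or_odd' n
    · rw [hd, tailIdeal_odd, Ideal.mem_span_pair] at hv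
      rw [hd] at hu ih ⊢
      obtain ⟨a, b, rfl⟩ := hv
      -- Modulo `(x, y)` both `g₂` and `g₃` vanish, while `g₁` and `f` stay outside this prime.
      have ha : a ∈ Ideal.span {x, y} := by
        refine H.mem_span_of_mul_f_pow (d := d) ?_
        refine (hprime.mem_or_mem (?_ : a * f ^ d * g₁ ∈ _)).resolve_right H.g₁_notMem
        rw [Ideal.mem_span_pair]
        refine ⟨h + z * u - b * x ^ (e + 2) * f ^ d, -y * u + b * z ^ (p + 1) * f ^ d, ?_⟩
        have h₂ := H.g₂_eq
        have h₃ := H.g₃_eq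
        linear_combination -huv + u * h₃ + b * f ^ d * h₂
      obtain ⟨a'', a', rfl⟩ := Ideal.mem_span_pair.1 ha
      -- Replacing `a' * y * g₁` by `y_mul_g₁` changes the coefficient of `g₂` to `b + a' * z`.
      -- Modulo `x` a factor `y` then cancels.
      have hb : b + a' * z ∈ Ideal.span {x, y} := by
        have hdvd : x ∣ y * u - (b + a' * z) * z ^ (p + 1) * f ^ d := by
          refine dvd_of_y ⟨h + z * u - (b + a' * z) * x ^ (e + 2) * f ^ d
            - a' * x ^ (e + 1) * g₃ * f ^ d - a'' * g₁ * f ^ d, ?_⟩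
          have h₁ := H.y_mul_g₁
          have h₂ := H.g₂_eq
          have h₃ := H.g₃_eq
          linear_combination huv - u * h₃ - a' * f ^ d * h₁ - (b + a' * z) * f ^ d * h₂
        obtain ⟨t, ht⟩ := hdvd
        refine H.mem_span_of_mul_f_pow (d := d) ?_
        refine (hprime.mem_or_mem (?_ : (b + a' * z) * f ^ d * z ^ (p + 1) ∈ _)).resolve_right
          fun h => H.z_notMem (hprime.mem_of_pow_mem _ h)
        rw [Ideal.mem_span_pair]
        exact ⟨-t, u, by linear_combination ht⟩
      obtain ⟨b₂, b₁, hb⟩ := Ideal.mem_span_pair.1 hb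
      set r := a' * x ^ (e + 1) * (g₃ * f ^ d) + (a'' + b₁) * (g₁ * f ^ d) + b₂ * (g₂ * f ^ d)
        with hr
      have key : x * h = g₃ * (u - b₁ * z ^ (p + 1) * f ^ d) + x * r := by
        have h₁ := H.y_mul_g₁
        have h₂ := H.y_mul_g₂
        rw [hr]
        linear_combination -huv + a' * f ^ d * h₁ + b₁ * f ^ d * h₂ - g₂ * f ^ d * hb
      obtain ⟨w, hw⟩ := H.dvd_of_dvd_g₃_mul (u := u - b₁ * z ^ (p + 1) * f ^ d)
        ⟨h - r, by linear_combination -key⟩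
      have hwL := ih (h := w) (hw ▸ sub_mem hu (Ideal.mul_mem_left _ _ (f_pow_mem_reducedIdeal d)))
      have : h = g₃ * w + r := mul_left_cancel₀ hx0 (by linear_combination key + g₃ * hw)
      rw [this]
      exact add_mem (g₃_mul_mem_reducedIdeal hwL) (add_mem (add_mem
        (Ideal.mul_mem_left _ _ (g₃_mul_mem_reducedIdeal (f_pow_mem_reducedIdeal d)))
        (Ideal.mul_mem_left _ _ (g₁_mul_f_pow_mem_reducedIdeal d)))
        (Ideal.mul_mem_left _ _ (g₂_mul_f_pow_mem_reducedIdeal d)))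
    · have hd' : n + 1 = 2 * (d + 1) := by omega
      rw [hd', tailIdeal_even, Ideal.mem_span_singleton'] at hv
      rw [hd] at hu ih ⊢
      obtain ⟨c, rfl⟩ := hv
      have hc : c ∈ Ideal.span {x, y} := by
        refine H.mem_span_of_mul_f_pow (d := d + 1) ?_
        rw [Ideal.mem_span_pair]
        have h₃ := H.g₃_eq
        exact ⟨h + z * u, -y * u, by linear_combination -huv + u * h₃⟩
      obtain ⟨c₂, c₁, rfl⟩ := Ideal.mem_span_pair.1 hc
      -- Since `g₃` is `y ^ 2` modulo `x`, one `y` cancels and a second one must divide the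
      -- coefficient of `f ^ (d + 1)`. This makes `y_sq_mul_f` applicable.
      have hc₁ : c₁ ∈ Ideal.span {x, y} := by
        have hdvd : x ∣ y * u + c₁ * f ^ (d + 1) := by
          have h₃ := H.g₃_eq
          exact dvd_of_y ⟨h + z * u - c₂ * f ^ (d + 1), by linear_combination huv - u * h₃⟩
        obtain ⟨t, ht⟩ := hdvd
        refine H.mem_span_of_mul_f_pow (d := d + 1) ?_
        rw [Ideal.mem_span_pair]
        exact ⟨t, -u, by linear_combination -ht⟩
      obtain ⟨c₃, c', rfl⟩ := Ideal.mem_span_pair.1 hc₁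
      set r := (c₂ + c₃ * y) * f ^ (d + 1) - c' * (f ^ d * (g₁ * g₁))
        - c' * x ^ e * y * z ^ p * (f ^ d * (g₃ * g₃)) with hr
      have key : x * h = g₃ * (u + c' * z ^ (p + 1) * (g₁ * f ^ d)) + x * r := by
        have h₁ := H.y_sq_mul_f
        rw [hr]
        linear_combination -huv + c' * f ^ d * h₁
      obtain ⟨w, hw⟩ := H.dvd_of_dvd_g₃_mul (u := u + c' * z ^ (p + 1) * (g₁ * f ^ d))
        ⟨h - r, by linear_combination -key⟩
      have hwL := ih (h := w)
        (hw ▸ add_mem hu (Ideal.mul_mem_left _ _ (g₁_mul_f_pow_mem_reducedIdeal d)))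
      have : h = g₃ * w + r := mul_left_cancel₀ hx0 (by linear_combination key + g₃ * hw)
      rw [this]
      have e2 : 2 * d + 1 + 1 = 2 + 2 * d := by ring
      refine add_mem (g₃_mul_mem_reducedIdeal hwL) (sub_mem (sub_mem ?_ ?_) ?_) <;>
        refine Ideal.mul_mem_left _ _ ?_
      · exact f_pow_mem_reducedIdeal (d + 1)
      · rw [e2]
        exact f_pow_mul_mem_reducedIdeal H.g₁_mul_g₁_mem d
      · rw [e2]
        exact f_pow_mul_mem_reducedIdeal (g₃_mul_mem_reducedIdeal g₃_mem) d

theorem mem_reducedIdeal_of_pow_mul_mem [IsDomain R] (H : CurveRelations x y z g₁ g₂ g₃ f p e)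
    {n a : ℕ} {h : R} (hh : x ^ a * h ∈ reducedIdeal g₁ g₂ g₃ f n) :
    h ∈ reducedIdeal g₁ g₂ g₃ f n := by
  induction a with
  | zero => simpa using hh
  | succ a ih =>
    rw [pow_succ', mul_assoc] at hh
    exact ih (H.mem_reducedIdeal_of_mul_mem hh)

/-- `x * f` lies in the square of `(g₁, g₂, g₃)`. -/
theorem x_mul_f_mem (H : CurveRelations x y z g₁ g₂ g₃ f p e) :
    x * f ∈ Ideal.span {g₁, g₂, g₃} ^ 2 := by
  rw [show x * f = -z ^ p * (g₁ * g₃) - g₂ * g₂ by rw [H.g₂_mul_g₂]; ring, sq]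
  exact sub_mem (Ideal.mul_mem_left _ _ (Ideal.mul_mem_mul (Ideal.subset_span (by simp))
    (Ideal.subset_span (by simp)))) (Ideal.mul_mem_mul (Ideal.subset_span (by simp))
    (Ideal.subset_span (by simp)))

end CurveRelations

/-! ### Monomials and primes in power series rings -/

noncomputable section

namespace MvPowerSeries

theorem mem_span_monomial_of_le {σ R : Type*} [CommRing R] {s : σ →₀ ℕ} {f : MvPowerSeries σ R}
    (h : ∀ d, coeff d f ≠ 0 → s ≤ d) : f ∈ Ideal.span {monomial s (1 : R)} := by
  let g : MvPowerSeries σ R := fun d => coeff (s + d) f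
  have hg (d) : coeff d g = coeff (s + d) f := rfl
  refine Ideal.mem_span_singleton.2 ⟨g, ?_⟩
  ext d
  classical
  rw [coeff_monomial_mul, one_mul]
  split_ifs with hd
  · rw [hg, add_tsub_cancel_of_le hd]
  · exact not_imp_comm.1 (h d) hd

/-- A power series all of whose exponents are bounded below by an element of the finite set `S`
lies in the ideal generated by the monomials with exponents in `S`. -/
theorem mem_span_monomial_image {σ R : Type*} [CommRing R] (S : Finset (σ →₀ ℕ))
    {f : MvPowerSeries σ R} (h : ∀ d, coeff d f ≠ 0 → ∃ s ∈ S, s ≤ d) :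
    f ∈ Ideal.span ((fun s => monomial s (1 : R)) '' (S : Set (σ →₀ ℕ))) := by
  classical
  induction S using Finset.induction_on generalizing f with
  | empty =>
    have : f = 0 := by
      ext d
      by_contra hd
      obtain ⟨s, hs, -⟩ := h d hd
      simp at hs
    rw [this]
    exact zero_mem _
  | insert s S _ ih =>
    -- `f₁` collects the terms divisible by the new monomial; the exponents of the remainder are
    -- covered by `S`.
    let f₁ : MvPowerSeries σ R := fun d => if s ≤ d then coeff d f else 0
    have hf₁ (d) : coeff d f₁ = if s ≤ d then coeff d f else 0 := rfl
    rw [Finset.coe_insert, Set.image_insert_eq, Ideal.span_insert, ← add_sub_cancel f₁ f]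
    refine add_mem (Ideal.mem_sup_left (mem_span_monomial_of_le fun d hd => ?_))
      (Ideal.mem_sup_right (ih fun d hd => ?_))
    · by_contra hsd
      simp [hf₁, hsd] at hd
    · rw [map_sub, hf₁] at hd
      split_ifs at hd with hsd
      · simp at hd
      · rw [sub_zero] at hd
        obtain ⟨t, ht, htd⟩ := h d hd
        rcases Finset.mem_insert.1 ht with rfl | ht
        · exact absurd htd hsd
        · exact ⟨t, ht, htd⟩

/-- The homomorphism that sets the first variable to zero. -/
def dropZero (n : ℕ) (k : Type*) [CommRing k] :
    MvPowerSeries (Fin (n + 1)) k →+* MvPowerSeries (Fin n) k :=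
  (PowerSeries.constantCoeff (R := MvPowerSeries (Fin n) k)).comp
    (finSuccEquiv k n).toRingEquiv.toRingHom

theorem coeff_dropZero {n : ℕ} {k : Type*} [CommRing k] (f : MvPowerSeries (Fin (n + 1)) k)
    (d : Fin n →₀ ℕ) : coeff d (dropZero n k f) = coeff (d.cons 0) f := by
  rw [← coeff_coeff_finSuccEquiv, PowerSeries.coeff_zero_eq_constantCoeff_apply]
  rfl

theorem prime_X_zero (n : ℕ) (k : Type*) [CommRing k] [IsDomain k] :
    Prime (X 0 : MvPowerSeries (Fin (n + 1)) k) := by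
  have : IsDomain (MvPowerSeries (Fin n) k) := NoZeroDivisors.to_isDomain _
  rw [← MulEquiv.prime_iff (finSuccEquiv k n), finSuccEquiv_X_zero]
  exact PowerSeries.X_prime

theorem monomial_one_eq_of_fin_three {k : Type*} [CommRing k] (a b c : ℕ) :
    monomial (Finsupp.equivFunOnFinite.symm ![a, b, c]) (1 : k) = X 0 ^ a * X 1 ^ b * X 2 ^ c := by
  rw [monomial_one_eq, Finsupp.prod_fintype _ _ (by simp), Fin.prod_univ_three]
  rfl

theorem finsupp_le_iff_of_fin_three {a b c : ℕ} {d : Fin 3 →₀ ℕ} :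
    Finsupp.equivFunOnFinite.symm ![a, b, c] ≤ d ↔ a ≤ d 0 ∧ b ≤ d 1 ∧ c ≤ d 2 := by
  simp [Finsupp.le_def, Fin.forall_fin_succ]

/-- The ideal is the kernel of setting two variables to zero, a map into a domain. -/
theorem isPrime_span_X_zero_X_one (k : Type*) [CommRing k] [IsDomain k] :
    (Ideal.span {X 0, X 1} : Ideal (MvPowerSeries (Fin 3) k)).IsPrime := by
  have : IsDomain (MvPowerSeries (Fin 1) k) := NoZeroDivisors.to_isDomain _
  have : Ideal.span {X 0, X 1} = RingHom.ker ((dropZero 1 k).comp (dropZero 2 k)) := by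
    apply le_antisymm
    · rw [Ideal.span_le]
      rintro _ (rfl | rfl)
      · ext d
        simp [coeff_dropZero, coeff_X, Finsupp.ext_iff, Fin.forall_fin_succ]
      · ext d
        simp [coeff_dropZero, coeff_X, Finsupp.ext_iff, Fin.forall_fin_succ,
          Finsupp.single_apply]
    · intro f hf
      have := mem_span_monomial_image
        {Finsupp.equivFunOnFinite.symm ![1, 0, 0], Finsupp.equivFunOnFinite.symm ![0, 1, 0]}
        (f := f) fun d hd => ?_
      · rw [Finset.coe_pair, Set.image_pair] at this
        simpa [monomial_one_eq_of_fin_three] using this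
      · simp only [Finset.mem_insert, Finset.mem_singleton, exists_eq_or_imp, exists_eq_left,
          finsupp_le_iff_of_fin_three, zero_le, and_true, true_and]
        by_contra! h
        apply hd
        have h₂ := congrArg (coeff d.tail.tail) (RingHom.mem_ker.1 hf)
        rw [RingHom.comp_apply, coeff_dropZero, coeff_dropZero, coeff_zero] at h₂
        rw [← h₂]
        refine congrArg (fun t => coeff t f) (Finsupp.ext fun i => ?_)
        fin_cases i
        · change d 0 = 0
          omega
        · change d 1 = 0
          omega
        · rfl
  rw [this]
  exact RingHom.ker_isPrime _

end MvPowerSeries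

/-! ### The parametrization and denominators of symbolic powers -/

namespace MonomialCurve
open MvPowerSeries

variable (k : Type*) [Field k] (q m : ℕ)

/-- The weight of a monomial: the exponent of its image in `k[[t]]`. -/
def weight (d : Fin 3 →₀ ℕ) : ℕ :=
  (2 * q + 1) * d 0 + (2 * q + 1 + m) * d 1 + (2 * q + 1 + 2 * m) * d 2

variable {k q m}

theorem prod_param (d : Fin 3 →₀ ℕ) :
    (d.prod fun i n => param k q m i ^ n) = PowerSeries.X ^ weight q m d := by
  rw [Finsupp.prod_fintype _ _ (by simp), Fin.prod_univ_three]
  simp only [param, ← pow_mul, ← pow_add, weight]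
  simp

open Classical in
theorem coeff_phi (f : MvPowerSeries (Fin 3) k) (e : ℕ) :
    PowerSeries.coeff e (phi k q m f) = ∑ᶠ d, if weight q m d = e then coeff d f else 0 := by
  have h := coeff_subst (hasSubst_param k q m) f (Finsupp.single () e)
  rw [← substAlgHom_apply (hasSubst_param k q m)] at h
  refine Eq.trans h (finsum_congr fun d => ?_)
  have h₂ := congrArg (PowerSeries.coeff e) (prod_param (k := k) (q := q) (m := m) d)
  rw [PowerSeries.coeff_X_pow] at h₂
  refine (congrArg (coeff d f • ·) h₂).trans ?_
  simp [eq_comm]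

/-- No other monomial of `f` reaches the same power of `t`, so nothing can cancel. -/
theorem coeff_phi_of_unique {f : MvPowerSeries (Fin 3) k} {d : Fin 3 →₀ ℕ}
    (h : ∀ d', coeff d' f ≠ 0 → weight q m d' = weight q m d → d' = d) :
    PowerSeries.coeff (weight q m d) (phi k q m f) = coeff d f := by
  classical
  rw [coeff_phi, finsum_eq_single _ d, if_pos rfl]
  intro d' hd'
  split_ifs with hw
  · by_contra h₀
    exact hd' (h d' h₀ hw)
  · rfl

theorem phi_X (i : Fin 3) : phi k q m (X i) = PowerSeries.X ^ (2 * q + 1 + (i : ℕ) * m) :=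
  substAlgHom_X (hasSubst_param k q m) i

/-- The numerical semigroup generated by the coprime numbers `2q+1` and `2q+1+m` already has finite
complement. -/
theorem exists_weight_eq (hqm : Nat.Coprime (2 * q + 1) m) :
    ∃ C, ∀ e ≥ C, ∃ d, weight q m d = e := by
  obtain ⟨C, hC⟩ := Nat.exists_mem_closure_of_ge {2 * q + 1, 2 * q + 1 + m}
  refine ⟨C, fun e he => ?_⟩
  have h := hC e he ?_
  · obtain ⟨a, b, h⟩ := (AddSubmonoid.mem_closure_pair _ _ _).1 h
    refine ⟨Finsupp.equivFunOnFinite.symm ![a, b, 0], ?_⟩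
    rw [← h]
    simp [weight, mul_comm]
  · have h₁ : Nat.setGcd {2 * q + 1, 2 * q + 1 + m} ∣ 2 * q + 1 :=
      Nat.setGcd_dvd_of_mem (by simp)
    have h₂ : Nat.setGcd {2 * q + 1, 2 * q + 1 + m} ∣ 2 * q + 1 + m :=
      Nat.setGcd_dvd_of_mem (by simp)
    have h₃ := Nat.dvd_gcd h₁ ((Nat.dvd_add_right h₁).1 h₂)
    rw [hqm] at h₃
    exact h₃.trans (one_dvd e)

/-- The image of the substitution homomorphism contains all series of large order. -/
theorem exists_X_pow_mul_mem_range (hqm : Nat.Coprime (2 * q + 1) m) :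
    ∃ C, ∀ w : PowerSeries k, PowerSeries.X ^ C ∣ w → ∃ r, phi k q m r = w := by
  classical
  obtain ⟨C, hC⟩ := exists_weight_eq hqm
  choose! D hD using hC
  refine ⟨C, fun w hw => ?_⟩
  -- One monomial `D e` is chosen for each weight `e ≥ C` and carries the coefficient of `t^e` in
  -- `w`.
  let r : MvPowerSeries (Fin 3) k := fun d =>
    if C ≤ weight q m d ∧ D (weight q m d) = d then PowerSeries.coeff (weight q m d) w else 0
  have hr (d) : coeff d r = if C ≤ weight q m d ∧ D (weight q m d) = d then
    PowerSeries.coeff (weight q m d) w else 0 := rfl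
  refine ⟨r, ?_⟩
  ext e
  by_cases he : C ≤ e
  · have h := coeff_phi_of_unique (q := q) (m := m) (f := r) (d := D e) fun d' hd' hw => by
      rw [hr] at hd'
      split_ifs at hd' with h
      · rw [← h.2, hw, hD e he]
      · exact absurd rfl hd'
    rw [hr, hD e he] at h
    rw [h, if_pos ⟨he, rfl⟩]
  · rw [coeff_phi, PowerSeries.X_pow_dvd_iff.1 hw e (not_le.1 he)]
    refine finsum_eq_zero_of_forall_eq_zero fun d => ?_
    split_ifs with h
    · rw [hr, if_neg (by rw [h]; exact fun h => he h.1)]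
    · rfl

/-- Outside the curve ideal every element divides a power of `x₁` modulo the curve ideal. -/
theorem exists_mul_sub_X_pow_mem (hqm : Nat.Coprime (2 * q + 1) m) {s : MvPowerSeries (Fin 3) k}
    (hs : s ∉ curveIdeal k q m) : ∃ r a, r * s - X 0 ^ a ∈ curveIdeal k q m := by
  obtain ⟨C, hC⟩ := exists_X_pow_mul_mem_range (k := k) hqm
  have hs' : phi k q m s ≠ 0 := hs
  obtain ⟨n, u, hu⟩ : ∃ (n : ℕ) (u : PowerSeries k), phi k q m s * u = PowerSeries.X ^ n := by
    obtain ⟨n, u, hu⟩ := IsDiscreteValuationRing.associated_pow_irreducible hs'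
      (PowerSeries.X_prime (R := k)).irreducible
    exact ⟨n, u, hu⟩
  -- `X 0 ^ (n + C)` maps to `t^n * t^(C + l)`: the factor `t^n` is `phi s * u`, and `u * t^(C + l)`
  -- has order at least `C`, hence lies in the image.
  obtain ⟨l, hl⟩ : ∃ l, (2 * q + 1) * (n + C) = n + C + l := Nat.exists_eq_add_of_le (by nlinarith)
  have hdvd : (PowerSeries.X ^ C : PowerSeries k) ∣ u * PowerSeries.X ^ (C + l) :=
    ⟨u * PowerSeries.X ^ l, by ring⟩
  obtain ⟨r, hr⟩ := hC _ hdvd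
  refine ⟨r, n + C, ?_⟩
  change phi k q m _ = 0
  rw [map_sub, map_mul, map_pow, phi_X, hr, sub_eq_zero, mul_right_comm, mul_comm u, hu, ← pow_add, ← pow_mul]
  congr 1
  simp
  omega

theorem X_zero_notMem_curveIdeal : X 0 ∉ curveIdeal k q m := fun h => by
  have : phi k q m (X 0) = 0 := h
  rw [phi_X] at this
  exact pow_ne_zero _ PowerSeries.X_ne_zero this

theorem exists_X_pow_mul_mem (hqm : Nat.Coprime (2 * q + 1) m) {n : ℕ}
    {f : MvPowerSeries (Fin 3) k} (hf : f ∈ symbolicPower (curveIdeal k q m) n) :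
    ∃ a, X 0 ^ a * f ∈ curveIdeal k q m ^ n := by
  rw [symbolicPower, Ideal.mem_comap, IsLocalization.algebraMap_mem_map_algebraMap_iff
    (curveIdeal k q m).primeCompl] at hf
  obtain ⟨s, hs, hsf⟩ := hf
  obtain ⟨r, a, hra⟩ := exists_mul_sub_X_pow_mem hqm hs
  refine ⟨a * n, ?_⟩
  -- `X 0 ^ a - r * s` lies in the curve ideal, so its `n`-th power lies in the `n`-th power of that
  -- ideal and differs from `X 0 ^ (a * n)` by a multiple of `s`.
  obtain ⟨t, ht⟩ := sub_dvd_pow_sub_pow (X 0 ^ a) (X 0 ^ a - r * s) n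
  rw [sub_sub_cancel] at ht
  have h : X 0 ^ (a * n) * f = r * t * (s * f) + (X 0 ^ a - r * s) ^ n * f := by
    rw [pow_mul]
    linear_combination f * ht
  rw [h]
  refine add_mem (Ideal.mul_mem_left _ _ hsf) (Ideal.mul_mem_right _ _ (Ideal.pow_mem_pow ?_ n))
  rw [← neg_sub]
  exact neg_mem hra

end MonomialCurve
end

/-! ### Symbolic powers, weighted sums and monomial ideals -/

noncomputable section

section symbolicPower

variable {A : Type*} [CommRing A] (P : Ideal A) [P.IsPrime]

theorem mem_symbolicPower_iff {n : ℕ} {f : A} :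
    f ∈ symbolicPower P n ↔ ∃ s ∉ P, s * f ∈ P ^ n := by
  rw [symbolicPower, Ideal.mem_comap,
    IsLocalization.algebraMap_mem_map_algebraMap_iff P.primeCompl]
  rfl

theorem pow_le_symbolicPower (n : ℕ) : P ^ n ≤ symbolicPower P n :=
  Ideal.le_comap_map

theorem symbolicPower_mul_le (a b : ℕ) :
    symbolicPower P a * symbolicPower P b ≤ symbolicPower P (a + b) := by
  refine Ideal.mul_le.2 fun f hf g hg => ?_
  rw [mem_symbolicPower_iff] at *
  obtain ⟨s, hs, hsf⟩ := hf
  obtain ⟨t, ht, htg⟩ := hg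
  refine ⟨s * t, fun h => (‹P.IsPrime›.mem_or_mem h).elim hs ht, ?_⟩
  rw [mul_mul_mul_comm, pow_add]
  exact Ideal.mul_mem_mul hsf htg

theorem symbolicPower_pow_le (a n : ℕ) : symbolicPower P a ^ n ≤ symbolicPower P (a * n) := by
  induction n with
  | zero => simpa using pow_le_symbolicPower P 0
  | succ n ih =>
    rw [pow_succ, mul_add, mul_one]
    exact (Ideal.mul_mono_left ih).trans (symbolicPower_mul_le P _ _)

theorem weightedSum_le_symbolicPower (n : ℕ) :
    weightedSum P (symbolicPower P 2) n ≤ symbolicPower P n := by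
  refine iSup₂_le fun a ha => ?_
  rw [← ha]
  exact (Ideal.mul_mono (pow_le_symbolicPower P _) (symbolicPower_pow_le P _ _)).trans
    (symbolicPower_mul_le P _ _)

end symbolicPower

theorem weightedSum_mono {A : Type*} [CommSemiring A] {I I' J J' : Ideal A} (hI : I ≤ I')
    (hJ : J ≤ J') (n : ℕ) : weightedSum I J n ≤ weightedSum I' J' n :=
  iSup₂_mono fun _ _ => Ideal.mul_mono (Ideal.pow_right_mono hI _) (Ideal.pow_right_mono hJ _)

theorem map_weightedSum {A B : Type*} [CommSemiring A] [CommSemiring B] {F : Type*}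
    [FunLike F A B] [RingHomClass F A B] (φ : F) (I J : Ideal A) (n : ℕ) :
    (weightedSum I J n).map φ = weightedSum (I.map φ) (J.map φ) n := by
  simp only [weightedSum, Ideal.map_iSup, Ideal.map_mul, Ideal.map_pow]

namespace MvPolynomial

variable {σ R : Type*} [CommRing R]

/-- An ideal of a polynomial ring that is generated by monomials. -/
def IsMonomialIdeal (I : Ideal (MvPolynomial σ R)) : Prop :=
  ∃ S : Set (σ →₀ ℕ), I = Ideal.span ((fun s => monomial s (1 : R)) '' S)

theorem IsMonomialIdeal.mul {I J : Ideal (MvPolynomial σ R)} (hI : IsMonomialIdeal I)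
    (hJ : IsMonomialIdeal J) : IsMonomialIdeal (I * J) := by
  obtain ⟨S, rfl⟩ := hI
  obtain ⟨T, rfl⟩ := hJ
  refine ⟨Set.image2 (· + ·) S T, ?_⟩
  rw [Ideal.span_mul_span', ← Set.image2_mul, Set.image2_image_left, Set.image2_image_right,
    Set.image_image2]
  simp

theorem IsMonomialIdeal.pow {I : Ideal (MvPolynomial σ R)} (hI : IsMonomialIdeal I) (n : ℕ) :
    IsMonomialIdeal (I ^ n) := by
  induction n with
  | zero => exact ⟨{0}, by simp⟩
  | succ n ih => exact pow_succ I n ▸ ih.mul hI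

theorem IsMonomialIdeal.iSup {ι : Sort*} {I : ι → Ideal (MvPolynomial σ R)}
    (hI : ∀ i, IsMonomialIdeal (I i)) : IsMonomialIdeal (⨆ i, I i) := by
  choose S hS using hI
  refine ⟨⋃ i, S i, ?_⟩
  rw [Set.image_iUnion, Ideal.span_iUnion]
  exact iSup_congr hS

theorem IsMonomialIdeal.weightedSum {I J : Ideal (MvPolynomial σ R)} (hI : IsMonomialIdeal I)
    (hJ : IsMonomialIdeal J) (n : ℕ) : IsMonomialIdeal (weightedSum I J n) :=
  .iSup fun _ => .iSup fun _ => (hI.pow _).mul (hJ.pow _)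

/-- Monomial ideals are contracted from the power series ring. -/
theorem IsMonomialIdeal.comap_map {I : Ideal (MvPolynomial σ R)} (hI : IsMonomialIdeal I) :
    (I.map (coeToMvPowerSeries.ringHom (R := R) (σ := σ))).comap
      (coeToMvPowerSeries.ringHom (R := R) (σ := σ)) = I := by
  refine le_antisymm (fun f hf => ?_) Ideal.le_comap_map
  obtain ⟨S, rfl⟩ := hI
  -- Having every exponent above some element of `S` survives sums and multiples, and for a
  -- polynomial it characterizes membership.
  have key : ∀ g ∈ (Ideal.span ((fun s => monomial s (1 : R)) '' S)).map
      (coeToMvPowerSeries.ringHom (R := R) (σ := σ)),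
      ∀ d, MvPowerSeries.coeff d g ≠ 0 → ∃ s ∈ S, s ≤ d := by
    intro g hg
    rw [Ideal.map_span] at hg
    induction hg using Submodule.span_induction with
    | mem g hg =>
      obtain ⟨_, ⟨s, hs, rfl⟩, rfl⟩ := hg
      intro d hd
      rw [coeToMvPowerSeries.ringHom_apply, coe_monomial] at hd
      exact ⟨s, hs, (MvPowerSeries.eq_of_coeff_monomial_ne_zero hd).ge⟩
    | zero => simp
    | add g h _ _ ihg ihh =>
      intro d hd
      by_cases hg : MvPowerSeries.coeff d g = 0
      · exact ihh d (by rwa [map_add, hg, zero_add] at hd)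
      · exact ihg d hg
    | smul a g _ ih =>
      classical
      intro d hd
      rw [smul_eq_mul, MvPowerSeries.coeff_mul] at hd
      obtain ⟨⟨u, v⟩, huv, h⟩ := Finset.exists_ne_zero_of_sum_ne_zero hd
      obtain ⟨s, hs, hsv⟩ := ih v (right_ne_zero_of_mul h)
      exact ⟨s, hs, hsv.trans ((self_le_add_left v u).trans
        (Finset.HasAntidiagonal.mem_antidiagonal.1 huv).le)⟩
  rw [mem_ideal_span_monomial_image]
  intro d hd
  refine key _ hf d ?_
  rw [coeToMvPowerSeries.ringHom_apply, coeff_coe]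
  exact mem_support_iff.1 hd

end MvPolynomial

/-! ### Setting `x₁ = 0`, and uniqueness of weights -/

namespace MonomialCurve

section poly
open MvPolynomial

variable (k : Type*) [Field k] (q m : ℕ)

theorem isMonomialIdeal_monI (n : ℕ) : IsMonomialIdeal (monI k q n) := by
  refine IsMonomialIdeal.weightedSum ⟨{Finsupp.single 0 2,
    Finsupp.single 0 1 + Finsupp.single 1 q, Finsupp.single 1 (q + 1)}, ?_⟩
    ⟨{Finsupp.single 1 (2 * q + 1)}, ?_⟩ n
  · have h : monomial (Finsupp.single 0 1 + Finsupp.single 1 q) (1 : k) =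
        (X 0 * X 1 ^ q : MvPolynomial (Fin 2) k) := by
      rw [X_pow_eq_monomial, X, monomial_mul, one_mul]
    rw [Set.image_insert_eq, Set.image_pair, h, ← X_pow_eq_monomial, ← X_pow_eq_monomial]
  · simp [X_pow_eq_monomial]

theorem map_reducePoly_calI {q m : ℕ} (hm : 1 ≤ m) (hq : 1 ≤ q) (n : ℕ) :
    (calI k q m n).map (reducePoly k) = monI k q n := by
  have hmq : m + q ≠ 0 := by omega
  have h₁ : reducePoly k (g₁ k q m) = -X 1 ^ (q + 1) := by
    simp [reducePoly, g₁, zero_pow hmq]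
  have h₂ : reducePoly k (g₂ k q m) = -(X 0 * X 1 ^ q) := by
    simp [reducePoly, g₂]
  have h₃ : reducePoly k (g₃ k) = X 0 ^ 2 := by
    simp [reducePoly, g₃]
  -- The term with `x₂³` disappears only because `m + q - 1` is positive.
  have h₄ : reducePoly k (f₂ k q m) = -X 1 ^ (2 * q + 1) := by
    simp [reducePoly, f₂, zero_pow hmq, zero_pow (show m + q - 1 ≠ 0 by omega)]
  rw [calI, map_weightedSum, monI, Ideal.map_span, Ideal.map_span]
  simp only [Set.image_insert_eq, Set.image_singleton, h₁, h₂, h₃, h₄]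
  congr 1
  · simp only [Ideal.span_insert, Ideal.span_singleton_neg]
    exact (sup_comm _ _).trans
      ((congrArg (· ⊔ _) (sup_comm _ _)).trans (sup_assoc _ _ _))
  · exact Ideal.span_singleton_neg _

theorem reduceSeries_comp_toSeries :
    (reduceSeries k).toRingHom.comp (toSeries k 3) =
      (toSeries k 2).comp (reducePoly k).toRingHom := by
  refine MvPolynomial.ringHom_ext (fun a => ?_) fun i => ?_
  · simp [toSeries, reduceSeries, reducePoly]
  · have := MvPowerSeries.subst_X (R := k) (hasSubst_reduce k)
    fin_cases i <;> simp [toSeries, reduceSeries, reducePoly, this]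

end poly

section series
open MvPowerSeries

variable {k : Type*} [Field k] {q m : ℕ}

theorem one_le_of_coprime (hq : 1 ≤ q) (hqm : Nat.Coprime (2 * q + 1) m) : 1 ≤ m := by
  by_contra! hm
  obtain rfl : m = 0 := by omega
  simp at hqm
  omega

/-- Coprimality gives `b' + 2c' = b + 2c + (2q+1)l`, and the weights then give `a + b' + c' + lm = b
+ c`. The size bounds force `l = 0`, whence `b' = b - 2a`, and `b ≤ 1` gives `a = 0`. -/
theorem eq_of_weight_eq (hq : 1 ≤ q) (hqm : Nat.Coprime (2 * q + 1) m) {d d' : Fin 3 →₀ ℕ}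
    (h₀ : d 0 = 0) (h₁ : d 1 ≤ 1) (h₂ : d 1 + 2 * d 2 ≤ 2 * q)
    (h : weight q m d' = weight q m d) : d' = d := by
  have hm := one_le_of_coprime hq hqm
  unfold weight at h
  suffices d' 0 = d 0 ∧ d' 1 = d 1 ∧ d' 2 = d 2 by
    ext i
    fin_cases i
    exacts [this.1, this.2.1, this.2.2]
  generalize d' 0 = a at *
  generalize d' 1 = b' at *
  generalize d' 2 = c' at *
  generalize d 1 = b at *
  generalize d 2 = c at *
  rw [h₀] at h ⊢
  zify at h h₁ h₂ hm hq
  have hdvd : ((2 * q + 1 : ℕ) : ℤ) ∣ (b' + 2 * c' - (b + 2 * c)) := by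
    refine (Nat.isCoprime_iff_coprime.2 hqm).dvd_of_dvd_mul_right ⟨b + c - a - b' - c', ?_⟩
    push_cast
    linear_combination h
  obtain ⟨l, hl⟩ := hdvd
  push_cast at hl
  have hl0 : 0 ≤ l := by
    by_contra! hneg
    nlinarith
  have hsum : (a + b' + c' + l * m : ℤ) = b + c := by
    have : (2 * q + 1 : ℤ) ≠ 0 := by positivity
    refine mul_left_cancel₀ this ?_
    linear_combination h - m * hl
  -- Eliminating `b'` and `c'` gives `(2q + 1 + 2m) * l ≤ b ≤ 1`.
  have hl1 : l = 0 := by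
    by_contra hne
    have hl1 : 1 ≤ l := by omega
    nlinarith
  subst hl1
  omega

end series

end MonomialCurve
end

/-! ### Generators of the curve ideal and the chain of inclusions -/

noncomputable section

namespace MonomialCurve
open MvPowerSeries

variable {k : Type*} [Field k] {q m : ℕ}

theorem toSeries_X {d : ℕ} (i : Fin d) : toSeries k d (MvPolynomial.X i) = X i :=
  MvPolynomial.coe_X i

theorem toSeries_g₁ : toSeries k 3 (g₁ k q m) = X 0 ^ (m + q) * X 1 - X 2 ^ (q + 1) := by
  simp only [g₁, map_sub, map_mul, map_pow, toSeries_X]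

theorem toSeries_g₂ : toSeries k 3 (g₂ k q m) = X 0 ^ (m + q + 1) - X 1 * X 2 ^ q := by
  simp only [g₂, map_sub, map_mul, map_pow, toSeries_X]

theorem toSeries_g₃ : toSeries k 3 (g₃ k) = X 1 ^ 2 - X 0 * X 2 := by
  simp only [g₃, map_sub, map_mul, map_pow, toSeries_X]

theorem toSeries_f₂ : toSeries k 3 (f₂ k q m) =
    - X 0 ^ (2 * (m + q) + 1) - X 0 ^ (m + q - 1) * X 1 ^ 3 * X 2 ^ (q - 1)
      + 3 * X 0 ^ (m + q) * X 1 * X 2 ^ q - X 2 ^ (2 * q + 1) := by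
  simp only [f₂, map_add, map_sub, map_neg, map_mul, map_pow, map_ofNat, toSeries_X]

theorem curveRelations (hq : 1 ≤ q) (hm : 1 ≤ m) :
    CurveRelations (X 0 : MvPowerSeries (Fin 3) k) (X 1) (X 2) (toSeries k 3 (g₁ k q m))
      (toSeries k 3 (g₂ k q m)) (toSeries k 3 (g₃ k)) (toSeries k 3 (f₂ k q m))
      (q - 1) (m + q - 2) where
  prime_x := prime_X_zero 2 k
  prime_xy := isPrime_span_X_zero_X_one k
  y_notMem h := by
    have := X_dvd_iff.1 h (Finsupp.single 1 1) (by simp)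
    simp at this
  z_notMem h := by
    rw [Ideal.mem_span_pair] at h
    obtain ⟨a, b, h⟩ := h
    have h₂ := congrArg (coeff (Finsupp.single 2 1)) h
    rw [map_add, mul_comm, mul_comm b, coeff_index_single_self_X] at h₂
    classical
    rw [X, X, coeff_monomial_mul, coeff_monomial_mul, if_neg, if_neg] at h₂
    · simp at h₂
    · simp
    · simp
  g₁_eq := by
    rw [toSeries_g₁, show m + q - 2 + 2 = m + q by omega, show q - 1 + 2 = q + 1 by omega]
  g₂_eq := by
    rw [toSeries_g₂, show m + q - 2 + 3 = m + q + 1 by omega, show q - 1 + 1 = q by omega]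
  g₃_eq := toSeries_g₃
  f_eq := by
    rw [toSeries_f₂, show 2 * (m + q - 2) + 5 = 2 * (m + q) + 1 by omega,
      show m + q - 2 + 1 = m + q - 1 by omega, show m + q - 2 + 2 = m + q by omega,
      show q - 1 + 1 = q by omega, show 2 * (q - 1) + 3 = 2 * q + 1 by omega]

theorem map_span_le_curveIdeal :
    (Ideal.span {g₁ k q m, g₂ k q m, g₃ k}).map (toSeries k 3) ≤ curveIdeal k q m := by
  rw [Ideal.map_span, Ideal.span_le]
  rintro _ ⟨_, rfl | rfl | rfl, rfl⟩ <;> change phi k q m _ = 0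
  · rw [toSeries_g₁]
    simp only [map_sub, map_mul, map_pow, phi_X, ← pow_mul, ← pow_add, sub_eq_zero]
    congr 1
    simp
    ring
  · rw [toSeries_g₂]
    simp only [map_sub, map_mul, map_pow, phi_X, ← pow_mul, ← pow_add, sub_eq_zero]
    congr 1
    simp
    ring
  · rw [toSeries_g₃]
    simp only [map_sub, map_mul, map_pow, phi_X, ← pow_mul, ← pow_add, sub_eq_zero]
    congr 1
    simp
    ring

/-- A monomial outside the right-hand ideal shares its weight with no other, so its coefficient in
an element of the kernel vanishes. -/
theorem curveIdeal_le_span_monomial (hq : 1 ≤ q) (hqm : Nat.Coprime (2 * q + 1) m) :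
    curveIdeal k q m ≤ Ideal.span {X 0, X 1 ^ 2, X 1 * X 2 ^ q, X 2 ^ (q + 1)} := by
  intro f hf
  have := mem_span_monomial_image (R := k) (f := f)
    {Finsupp.equivFunOnFinite.symm ![1, 0, 0], Finsupp.equivFunOnFinite.symm ![0, 2, 0],
      Finsupp.equivFunOnFinite.symm ![0, 1, q], Finsupp.equivFunOnFinite.symm ![0, 0, q + 1]}
    fun d hd => ?_
  · simp only [Finset.coe_insert, Finset.coe_singleton, Set.image_insert_eq,
      Set.image_singleton, monomial_one_eq_of_fin_three] at this
    simpa using this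
  · simp only [Finset.mem_insert, Finset.mem_singleton, exists_eq_or_imp, exists_eq_left,
      finsupp_le_iff_of_fin_three, zero_le, and_true, true_and]
    by_contra! h
    obtain ⟨h₀, h₁, h₂, h₃⟩ := h
    have h₄ : d 1 + 2 * d 2 ≤ 2 * q := by
      rcases Nat.lt_or_ge (d 1) 1 with h | h
      · omega
      · have := h₂ h
        omega
    apply hd
    rw [← coeff_phi_of_unique (q := q) (m := m) fun d' _ =>
      eq_of_weight_eq hq hqm (by omega) (by omega) h₄, show phi k q m f = 0 from hf, map_zero]

/-- The curve ideal is generated by `g₁, g₂, g₃`. -/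
theorem curveIdeal_eq_map_span (hq : 1 ≤ q) (hqm : Nat.Coprime (2 * q + 1) m) :
    curveIdeal k q m = (Ideal.span {g₁ k q m, g₂ k q m, g₃ k}).map (toSeries k 3) := by
  refine le_antisymm ?_ map_span_le_curveIdeal
  have hm := one_le_of_coprime hq hqm
  have hg {g} (hg : g ∈ ({g₁ k q m, g₂ k q m, g₃ k} : Set (MvPolynomial (Fin 3) k))) :
      toSeries k 3 g ∈ Ideal.span {X 0} ⊔
        (Ideal.span {g₁ k q m, g₂ k q m, g₃ k}).map (toSeries k 3) :=
    Ideal.mem_sup_right (Ideal.mem_map_of_mem _ (Ideal.subset_span hg))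
  have hX (r : MvPowerSeries (Fin 3) k) : X 0 * r ∈ Ideal.span {X 0} ⊔
        (Ideal.span {g₁ k q m, g₂ k q m, g₃ k}).map (toSeries k 3) :=
    Ideal.mul_mem_right _ _ (Ideal.mem_sup_left (Ideal.mem_span_singleton_self _))
  have hle : curveIdeal k q m ≤ Ideal.span {X 0} ⊔
      (Ideal.span {g₁ k q m, g₂ k q m, g₃ k}).map (toSeries k 3) := by
    refine (curveIdeal_le_span_monomial hq hqm).trans (Ideal.span_le.2 ?_)
    obtain ⟨e, he⟩ : ∃ e, m + q = e + 1 := ⟨m + q - 1, by omega⟩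
    rintro _ (rfl | rfl | rfl | rfl)
    · exact Ideal.mem_sup_left (Ideal.mem_span_singleton_self _)
    · have h := add_mem (hg (g := g₃ k) (by simp)) (hX (X 2))
      rwa [toSeries_g₃, sub_add_cancel] at h
    · have h := sub_mem (hX (X 0 ^ (m + q))) (hg (g := g₂ k q m) (by simp))
      rwa [toSeries_g₂, ← pow_succ', sub_sub_cancel] at h
    · have h := sub_mem (hX (X 0 ^ e * X 1)) (hg (g := g₁ k q m) (by simp))
      rwa [toSeries_g₁, ← mul_assoc, ← pow_succ', he, sub_sub_cancel] at h
  -- Nakayama: as `x₁` is not in the prime `P`, the inclusion `P ⊆ (x₁) + (g₁, g₂, g₃)` improves to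
  -- `P ⊆ (g₁, g₂, g₃) + x₁ P`.
  refine Submodule.le_of_le_smul_of_le_jacobson_bot (I := Ideal.span {X 0})
    (IsNoetherian.noetherian _) ?_ fun f hf => ?_
  · refine le_trans ?_ (IsLocalRing.maximalIdeal_le_jacobson ⊥)
    rw [Ideal.span_singleton_le_iff_mem, IsLocalRing.mem_maximalIdeal, mem_nonunits_iff]
    exact (prime_X_zero 2 k).not_isUnit
  · obtain ⟨_, hx, s, hs, rfl⟩ := Submodule.mem_sup.1 (hle hf)
    obtain ⟨r, rfl⟩ := Ideal.mem_span_singleton.1 hx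
    have hr : X 0 * r ∈ curveIdeal k q m := by
      simpa using sub_mem hf (map_span_le_curveIdeal hs)
    rw [add_comm]
    exact add_mem (Ideal.mem_sup_left hs) (Ideal.mem_sup_right (Ideal.mul_mem_mul
      (Ideal.mem_span_singleton_self _)
      ((Ideal.IsPrime.mem_or_mem inferInstance hr).resolve_left X_zero_notMem_curveIdeal)))

theorem map_toSeries_calI (n : ℕ) : (calI k q m n).map (toSeries k 3) =
    weightedSum (Ideal.span {toSeries k 3 (g₁ k q m), toSeries k 3 (g₂ k q m),
      toSeries k 3 (g₃ k)}) (Ideal.span {toSeries k 3 (f₂ k q m)}) n := by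
  simp only [calI, map_weightedSum, Ideal.map_span, Set.image_insert_eq, Set.image_singleton]

theorem curveIdeal_eq_span (hq : 1 ≤ q) (hqm : Nat.Coprime (2 * q + 1) m) :
    curveIdeal k q m = Ideal.span {toSeries k 3 (g₁ k q m), toSeries k 3 (g₂ k q m),
      toSeries k 3 (g₃ k)} := by
  simp only [curveIdeal_eq_map_span hq hqm, Ideal.map_span, Set.image_insert_eq,
    Set.image_singleton]

theorem symbolicPower_le_map_calI (hq : 1 ≤ q) (hqm : Nat.Coprime (2 * q + 1) m) (n : ℕ) :
    symbolicPower (curveIdeal k q m) n ≤ (calI k q m n).map (toSeries k 3) := by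
  intro f hf
  have : IsDomain (MvPowerSeries (Fin 3) k) := NoZeroDivisors.to_isDomain _
  have H := curveRelations (k := k) hq (one_le_of_coprime hq hqm)
  obtain ⟨a, ha⟩ := exists_X_pow_mul_mem hqm hf
  rw [curveIdeal_eq_span hq hqm] at ha
  rw [map_toSeries_calI]
  exact reducedIdeal_le_weightedSum n
    (H.mem_reducedIdeal_of_pow_mul_mem (H.span_pow_le_reducedIdeal n ha))

/-- `f₂` lies in the second symbolic power, with denominator `x₁`. -/
theorem map_calI_le_weightedSum (hq : 1 ≤ q) (hqm : Nat.Coprime (2 * q + 1) m) (n : ℕ) :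
    (calI k q m n).map (toSeries k 3) ≤
      weightedSum (curveIdeal k q m) (symbolicPower (curveIdeal k q m) 2) n := by
  rw [map_toSeries_calI, ← curveIdeal_eq_span hq hqm]
  refine weightedSum_mono le_rfl ?_ n
  rw [Ideal.span_singleton_le_iff_mem, mem_symbolicPower_iff]
  refine ⟨X 0, X_zero_notMem_curveIdeal, ?_⟩
  rw [curveIdeal_eq_span hq hqm]
  exact (curveRelations hq (one_le_of_coprime hq hqm)).x_mul_f_mem

end MonomialCurve
end

open MonomialCurve in
theorem mainTheorem1 (k : Type*) [Field k] (q m : ℕ) (hq : 1 ≤ q)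
    (hqm : Nat.Coprime (2 * q + 1) m) (n : ℕ) (hn : 1 ≤ n) :
    symbolicPower (curveIdeal k q m) n = (calI k q m n).map (toSeries k 3) ∧
    symbolicPower (curveIdeal k q m) n =
      weightedSum (curveIdeal k q m) (symbolicPower (curveIdeal k q m) 2) n ∧
    (symbolicPower (curveIdeal k q m) n).map (reduceSeries k) =
      (monI k q n).map (toSeries k 2) ∧
    ((symbolicPower (curveIdeal k q m) n).comap (toSeries k 3)).map (reducePoly k) =
      monI k q n ∧
    (calI k q m n).map (reducePoly k) = monI k q n := by
  have h₁ := symbolicPower_le_map_calI (k := k) hq hqm n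
  have h₂ := map_calI_le_weightedSum (k := k) hq hqm n
  have h₃ := weightedSum_le_symbolicPower (curveIdeal k q m) n
  have h₅ := map_reducePoly_calI k (one_le_of_coprime hq hqm) hq n
  have hcalI := h₁.antisymm (h₂.trans h₃)
  have hmap : (symbolicPower (curveIdeal k q m) n).map (reduceSeries k) =
      (monI k q n).map (toSeries k 2) := by
    rw [hcalI, ← h₅]
    have := congrArg (fun φ => (calI k q m n).map φ) (reduceSeries_comp_toSeries k)
    exact (Ideal.map_map _ _).trans (this.trans (Ideal.map_map _ _).symm)
  refine ⟨hcalI, (h₁.trans h₂).antisymm h₃, hmap, le_antisymm ?_ ?_, h₅⟩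
  · rw [Ideal.map_le_iff_le_comap]
    intro f hf
    -- It suffices to test membership of the image of `f` over power series, where `hmap` applies.
    refine (MvPolynomial.IsMonomialIdeal.comap_map (isMonomialIdeal_monI k q n)).le ?_
    have h := Ideal.mem_map_of_mem (reduceSeries k) (Ideal.mem_comap.1 hf)
    rw [hmap] at h
    have := RingHom.congr_fun (reduceSeries_comp_toSeries k) f
    exact (congrArg (· ∈ (monI k q n).map (toSeries k 2)) this).mp h
  · rw [← h₅]
    refine Ideal.map_mono ?_
    rw [hcalI]
    exact Ideal.le_comap_map
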